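/- Let $m,p,n\ge 1$ be integers with $p\mid m$. Let $G(m,p,n)\subset \mathrm{GL}_n(\mathbb{C})$ be the group of $n\times n$ matrices having exactly one non-zero entry in each row and each column, such that every non-zero entry is an $m$-th root of unity and the product of the non-zero entries is an $(m/p)$-th root of unity. Let $K\subset\mathbb{C}$ be a subfield containing all entries of all elements of $G=G(m,p,n)$. Then $G$ acts on $K[x_1,\dots,x_n]$ by $(\sigma\cdot f)(v)=f(\sigma^{-1}v)$; let $\mathcal{I}_G$ be the ideal generated by the $G$-invariant homogeneous polynomials of positive degree, and let $\mathcal{R}_G=K[x_1,\dots,x_n]/\mathcal{I}_G$ be the coinvariant algebra, with its grading by degree. A sub-staircase diagram of type $G(m,1,n)$ is a sequence $(a_1,\dots,a_n)$ of integers with $0\le a_i<im$ for all $i$. Its $p$-contraction is $(b_1,\dots,b_n)$, where, with $j$ the largest index such that $a_j<m$, one puts $b_i=a_i$ for $i<j$, $b_j=\lfloor a_j/p\rfloor$, and $b_i=a_i-m+m/p$ for $i>j$. A sub-staircase diagram of type $G(m,p,n)$ is the $p$-contraction of some sub-staircase diagram of type $G(m,1,n)$, and $\mathcal{A}(m,p,n)$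 is the set of monomials $x_1^{a_1}\cdots x_n^{a_n}$ with $(a_1,\dots,a_n)$ a sub-staircase diagram of type $G(m,p,n)$. Write $[k]_q=1+q+\cdots+q^{k-1}$. Then: 1. $\mathcal{A}(m,p,n)$ is the set of all $x_1^{a_1}\cdots x_n^{a_n}$ for which there is $j\in\{1,\dots,n\}$ such that $0\le a_i<im$ for all $i<j$, $0\le a_j<m/p$, and $0\le a_i-m/p<(i-1)m$ for all $i>j$. 2. The image of $\mathcal{A}(m,p,n)$ in $\mathcal{R}_G$ is a $K$-basis of $\mathcal{R}_G$ (distinct elements of $\mathcal{A}(m,p,n)$ having distinct images). 3. $\displaystyle\sum_{f\in\mathcal{A}(m,p,n)}q^{\deg f}=\sum_{d\ge 0}\dim_K\big((\mathcal{R}_G)_d\big)\,q^d=[m]_q[2m]_q\cdots[(n-1)m]_q\,[nm/p]_q.$ -/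

import Mathlib

namespace ShephardTodd

noncomputable section

/-- `M` is the pseudo-permutation matrix whose only nonzero entry in column `j` is `c j`, in
row `w j`, where every `c j` is an `m`-th root of unity and `(∏ j, c j) ^ (m / p) = 1`. -/
def IsPseudoPerm (m p : ℕ) {n : ℕ} (M : Matrix (Fin n) (Fin n) ℂ) : Prop :=
  ∃ (w : Equiv.Perm (Fin n)) (c : Fin n → ℂ),
    (∀ j, c j ^ m = 1) ∧ (∏ j, c j) ^ (m / p) = 1 ∧
      ∀ i j, M i j = if i = w j then c j else 0

theorem IsPseudoPerm.one (m p n : ℕ) :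
    IsPseudoPerm m p (1 : Matrix (Fin n) (Fin n) ℂ) :=
  ⟨1, fun _ => 1, by simp, by simp, fun i j => by
    by_cases h : i = j
    · subst h; simp
    · simp [h]⟩

theorem IsPseudoPerm.mul {m p n : ℕ} {M N : Matrix (Fin n) (Fin n) ℂ}
    (hM : IsPseudoPerm m p M) (hN : IsPseudoPerm m p N) : IsPseudoPerm m p (M * N) := by
  obtain ⟨w, c, hc, hcp, hM⟩ := hM
  obtain ⟨v, d, hd, hdp, hN⟩ := hN
  refine ⟨w * v, fun j => c (v j) * d j, fun j => ?_, ?_, fun i j => ?_⟩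
  · rw [mul_pow, hc, hd, one_mul]
  · rw [Finset.prod_mul_distrib, Equiv.prod_comp v c, mul_pow, hcp, hdp, one_mul]
  · rw [Matrix.mul_apply, Finset.sum_eq_single (v j)]
    · by_cases h : i = w (v j) <;> simp [hM, hN, h]
    · intro k _ hk
      simp [hN, hk]
    · simp

/-- The group `G(m, p, n)` (for `p ∣ m`, `m ≠ 0`) of complex pseudo-permutation matrices whose
nonzero entries are `m`-th roots of unity, the product of the nonzero entries being an
`(m / p)`-th root of unity. -/
def reflectionGroup (m p n : ℕ) (hm : m ≠ 0) : Subgroup (GL (Fin n) ℂ) where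
  carrier := {g | IsPseudoPerm m p (g : Matrix (Fin n) (Fin n) ℂ)}
  one_mem' := IsPseudoPerm.one m p n
  mul_mem' {g h} hg hh := by
    simpa using IsPseudoPerm.mul hg hh
  inv_mem' {g} hg := by
    obtain ⟨w, c, hc, hcp, hg⟩ := hg
    have hc0 : ∀ j, c j ≠ 0 := fun j h => by
      have := hc j
      rw [h, zero_pow hm] at this
      exact zero_ne_one this
    refine ⟨w⁻¹, fun j => (c (w⁻¹ j))⁻¹, fun j => by simp [hc], ?_, ?_⟩
    · rw [Equiv.prod_comp w⁻¹ (fun j => (c j)⁻¹), Finset.prod_inv_distrib, inv_pow, hcp, inv_one]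
    · set N : Matrix (Fin n) (Fin n) ℂ :=
        Matrix.of fun i j => if i = w⁻¹ j then (c (w⁻¹ j))⁻¹ else 0 with hN
      have key : (g : Matrix (Fin n) (Fin n) ℂ) * N = 1 := by
        ext i j
        rw [Matrix.mul_apply, Finset.sum_eq_single (w⁻¹ j)]
        · by_cases h : i = j
          · subst h
            simp [hg, hN, hc0]
          · simp [hg, h]
        · intro k _ hk
          rw [hN, Matrix.of_apply, if_neg hk, mul_zero]
        · simp
      have hinv : ((g⁻¹ : GL (Fin n) ℂ) : Matrix (Fin n) (Fin n) ℂ) = N := by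
        rw [Matrix.coe_units_inv]
        exact Matrix.inv_eq_right_inv key
      intro i j
      rw [hinv]
      rfl

/-- The matrices over the subfield `K` of `ℂ` that belong to `G(m, p, n)`. This is all of
`G(m, p, n)` as soon as the entries of the elements of `G(m, p, n)` lie in `K`. -/
def reflectionGroupOver (K : Subfield ℂ) (m p n : ℕ) (hm : m ≠ 0) : Subgroup (GL (Fin n) K) :=
  (reflectionGroup m p n hm).comap (Matrix.GeneralLinearGroup.map K.subtype)

section Coinvariants

variable {K : Type*} [Field K] {n : ℕ}

/-- The action `(g • f) v = f (g⁻¹ v)` of `GL_n(K)` on `K[x_1, …, x_n]`, where `x_j` is the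
`j`-th coordinate function on `K^n`. -/
def act (g : GL (Fin n) K) : MvPolynomial (Fin n) K →ₐ[K] MvPolynomial (Fin n) K :=
  MvPolynomial.aeval fun j => ∑ i,
    MvPolynomial.C ((g⁻¹ : GL (Fin n) K) j i) * MvPolynomial.X i

/-- The coinvariant ideal, generated by the `G`-invariant homogeneous polynomials of positive
degree. -/
def coinvariantIdeal (G : Subgroup (GL (Fin n) K)) : Ideal (MvPolynomial (Fin n) K) :=
  Ideal.span {f | (∀ g ∈ G, act g f = f) ∧ ∃ d, 0 < d ∧ f.IsHomogeneous d}

/-- The coinvariant algebra `K[x_1, …, x_n] / I_G`. -/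
abbrev CoinvariantAlgebra (G : Subgroup (GL (Fin n) K)) : Type _ :=
  MvPolynomial (Fin n) K ⧸ coinvariantIdeal G

/-- The degree `d` component of the coinvariant algebra: the image of the homogeneous polynomials
of degree `d`. -/
def gradedPiece (G : Subgroup (GL (Fin n) K)) (d : ℕ) : Submodule K (CoinvariantAlgebra G) :=
  (MvPolynomial.homogeneousSubmodule (Fin n) K d).map
    (Ideal.Quotient.mkₐ K (coinvariantIdeal G)).toLinearMap

/-- The Hilbert series `∑ d, (dim_K (R_G)_d) q^d` of the coinvariant algebra. -/
def hilbertSeries (G : Subgroup (GL (Fin n) K)) : PowerSeries ℤ :=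
  PowerSeries.mk fun d => (Module.finrank K (gradedPiece G d) : ℤ)

end Coinvariants

section Diagrams

variable {n : ℕ}

/-- Sub-staircase diagrams of type `G(m, 1, n)`, given by their row lengths from top to bottom:
in one-based indexing, row `i` has fewer than `i m` cells. -/
def IsSubstaircase (m : ℕ) (a : Fin n → ℕ) : Prop :=
  ∀ i, a i < (i.val + 1) * m

/-- The `p`-contraction. If `i` is the largest index of a row with fewer than `m` cells, then
the rows `k ≥ i` are exactly those with no row of fewer than `m` cells strictly below them. In
such a row, the `min (a k) m` leftmost cells (those in the rectangle of width `m`) shrink to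
`min (a k) m / p` cells, rounded down, and the remaining `a k - m` cells (truncated subtraction)
are kept. The rows `k < i` do not change. -/
def pContraction (m p : ℕ) (a : Fin n → ℕ) : Fin n → ℕ := fun k =>
  if ∀ l, k < l → m ≤ a l then min (a k) m / p + (a k - m) else a k

/-- Sub-staircase diagrams of type `G(m, p, n)`: the `p`-contractions of the sub-staircase
diagrams of type `G(m, 1, n)`. -/
def diagrams (m p n : ℕ) : Set (Fin n → ℕ) :=
  pContraction m p '' {a | IsSubstaircase m a}

/-- The monomials `x_1 ^ a_1 ⋯ x_n ^ a_n` for the sub-staircase diagrams `(a_1, …, a_n)` of type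
`G(m, p, n)`. -/
def artinBasis (K : Type*) [Field K] (m p n : ℕ) : Set (MvPolynomial (Fin n) K) :=
  (fun a : Fin n → ℕ => ∏ i, (MvPolynomial.X i : MvPolynomial (Fin n) K) ^ a i) ''
    diagrams m p n

/-- The Hilbert series of a set of monomials: the coefficient of `q^d` is the number of monomials
of degree `d` in the set. -/
def monomialSeries {K : Type*} [Field K] (A : Set (MvPolynomial (Fin n) K)) : PowerSeries ℤ :=
  PowerSeries.mk fun d => ({f | f ∈ A ∧ f.totalDegree = d}.ncard : ℤ)

/-- The `q`-integer `[k] = 1 + q + ⋯ + q^(k - 1)`. -/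
def qInt (k : ℕ) : PowerSeries ℤ :=
  ∑ i ∈ Finset.range k, PowerSeries.X ^ i

end Diagrams

end

end ShephardTodd

/-! Put `r = m / p` and index variables from 0. The coinvariant ideal contains `h_d(x_0^m, …,
x_{n-1}^m)` for `d > 0`, and `(∏ x_i)^r`. Dropping variables one at a time gives elements of the
ideal whose lexicographically leading monomials are `x_k^{(k+1)m}` and `x_k^{km} ∏_{i≥k} x_i^r`. The
monomials divisible by none of these are exactly those of the diagrams, so the diagrams span each
graded piece (`mono_mem_span_sup`).

Independence is a count. Splitting on the last row gives the generating function
(`sum_contractedFinset_pow_sum`), hence `n! m^{n-1} r` diagrams. This is also the size of an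
explicit family of points in the orbit of `(1, …, n)` (`exists_orbit`). Invariants are constant on
an orbit, so homogeneous polynomials spanning the coinvariants span all functions on these points
(`map_evalAt_span_eq_top`). No proper subfamily of the diagram monomials can therefore span. Since
all generators and monomials are homogeneous, both Hilbert series are read off the same count. -/

namespace ShephardTodd

open Finset

/-! ### Explicit description of the contracted diagrams -/

/-- The explicit description of the sub-staircase diagrams, with `r` in place of `m / p`. -/
def IsContracted (m r : ℕ) {n : ℕ} (a : Fin n → ℕ) : Prop :=
  ∃ j : Fin n, (∀ i, i < j → a i < (i.val + 1) * m) ∧ a j < r ∧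
    ∀ i, j < i → r ≤ a i ∧ a i - r < i.val * m

theorem isContracted_pContraction {m p n : ℕ} (hm : m ≠ 0) (hp : p ∣ m) (hn : 1 ≤ n)
    {a : Fin n → ℕ} (ha : IsSubstaircase m a) : IsContracted m (m / p) (pContraction m p a) := by
  classical
  have hp0 : 0 < p := Nat.pos_of_dvd_of_pos hp (Nat.pos_of_ne_zero hm)
  -- `j` is the last row shorter than `m`; row 0 always qualifies, so one exists.
  obtain ⟨j, hj, hmax⟩ : ∃ j : Fin n, a j < m ∧ ∀ l, j < l → m ≤ a l := by
    have hne : (univ.filter fun i => a i < m).Nonempty :=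
      ⟨⟨0, hn⟩, by simpa using ha ⟨0, hn⟩⟩
    refine ⟨(univ.filter fun i => a i < m).max' hne, ?_, fun l hl => ?_⟩
    · simpa using (univ.filter fun i => a i < m).max'_mem hne
    · by_contra h
      exact absurd hl (not_lt.2 (le_max' _ _ (by simpa using h)))
  refine ⟨j, fun i hi => ?_, ?_, fun i hi => ?_⟩
  · have : ¬ ∀ l, i < l → m ≤ a l := fun h => absurd (h j hi) (not_le.2 hj)
    simpa [pContraction, this] using ha i
  · have h : pContraction m p a j = a j / p := by
      simp [pContraction, if_pos hmax, hj.le]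
    rw [h]
    exact Nat.div_lt_div_of_lt_of_dvd hp hj
  · have h : pContraction m p a i = m / p + (a i - m) := by
      rw [pContraction, if_pos fun l hl => hmax l (hi.trans hl), min_eq_right (hmax i hi)]
    have h1 := hmax i hi
    have h2 := ha i
    rw [add_mul, one_mul] at h2
    rw [h]
    omega

theorem exists_pContraction_eq {m p n : ℕ} (hm : m ≠ 0) (hp : p ∣ m)
    {a : Fin n → ℕ} (ha : IsContracted m (m / p) a) :
    ∃ b, IsSubstaircase m b ∧ pContraction m p b = a := by
  have hp0 : 0 < p := Nat.pos_of_dvd_of_pos hp (Nat.pos_of_ne_zero hm)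
  obtain ⟨j, hlt, hj, hgt⟩ := ha
  have hjm : a j * p < m := by
    calc a j * p < m / p * p := Nat.mul_lt_mul_of_pos_right hj hp0
      _ = m := Nat.div_mul_cancel hp
  -- A section of the contraction: row `j` becomes a multiple of `p`, so that no cell is lost in
  -- rounding, and later rows regain `m - m / p` cells. They then have at least `m` cells, so `j` is
  -- again the last short row.
  set b : Fin n → ℕ := fun i => if i < j then a i else if i = j then a j * p else a i - m / p + m
    with hb
  have bj : b j = a j * p := by simp [hb]
  have bgt : ∀ i, j < i → b i = a i - m / p + m := fun i hi => by
    simp [hb, not_lt.2 hi.le, hi.ne']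
  have blt : ∀ i, i < j → b i = a i := fun i hi => by simp [hb, hi]
  refine ⟨b, fun i => ?_, funext fun i => ?_⟩
  · rcases lt_trichotomy i j with h | rfl | h
    · rw [blt i h]; exact hlt i h
    · rw [bj]; nlinarith
    · rw [bgt i h, add_mul, one_mul]
      exact Nat.add_lt_add_right (hgt i h).2 m
  · rcases lt_trichotomy i j with h | rfl | h
    · have : ¬ ∀ l, i < l → m ≤ b l := fun h' => by
        have := h' j h
        omega
      rw [pContraction, if_neg this, blt i h]
    · rw [pContraction, if_pos fun l hl => by rw [bgt l hl]; omega, bj, min_eq_left hjm.le,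
        Nat.mul_div_cancel _ hp0]
      omega
    · have h1 := (hgt i h).1
      rw [pContraction, if_pos fun l hl => by rw [bgt l (h.trans hl)]; omega, bgt i h,
        min_eq_right (by omega)]
      omega

theorem diagrams_eq {m p n : ℕ} (hm : m ≠ 0) (hp : p ∣ m) (hn : 1 ≤ n) :
    diagrams m p n = {a : Fin n → ℕ | IsContracted m (m / p) a} := by
  ext a
  constructor
  · rintro ⟨b, hb, rfl⟩
    exact isContracted_pContraction hm hp hn hb
  · exact fun ha => exists_pContraction_eq hm hp ha

theorem IsContracted.isSubstaircase {m r n : ℕ} (hr : r ≤ m) {a : Fin n → ℕ}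
    (ha : IsContracted m r a) : IsSubstaircase m a := by
  obtain ⟨j, hlt, hj, hgt⟩ := ha
  intro i
  rcases lt_trichotomy i j with h | rfl | h
  · exact hlt i h
  · nlinarith
  · have := hgt i h
    rw [add_mul, one_mul]
    omega

/-! ### Generating function of the diagrams by size -/

open Classical in
/-- The sub-staircase diagrams as a finite set. -/
noncomputable def contractedFinset (m r n : ℕ) : Finset (Fin n → ℕ) :=
  (Fintype.piFinset fun i : Fin n => range ((i.val + 1) * m)).filter (IsContracted m r)

theorem mem_contractedFinset {m r n : ℕ} (hr : r ≤ m) {a : Fin n → ℕ} :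
    a ∈ contractedFinset m r n ↔ IsContracted m r a := by
  classical
  simp only [contractedFinset, mem_filter, Fintype.mem_piFinset, mem_range, and_iff_right_iff_imp]
  exact fun ha => ha.isSubstaircase hr

/-- An earlier distinguished row would force the last row to have at least `r` cells. Hence the
distinguished row is the last one and the others are constrained only by the staircase. -/
theorem isContracted_snoc_of_lt {m r n : ℕ} {b : Fin n → ℕ} {t : ℕ} (ht : t < r) :
    IsContracted m r (Fin.snoc b t : Fin (n + 1) → ℕ) ↔ IsSubstaircase m b := by
  constructor
  · rintro ⟨j, hlt, hj, hgt⟩ i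
    have hjl : j = Fin.last n := by
      by_contra h
      have := (hgt _ (lt_of_le_of_ne (Fin.le_last j) h)).1
      simp only [Fin.snoc_last] at this
      omega
    subst hjl
    simpa using hlt i.castSucc (Fin.castSucc_lt_last i)
  · intro hb
    refine ⟨Fin.last n, fun i => ?_, by simpa using ht, fun i hi => ?_⟩
    · refine Fin.lastCases (fun h => absurd h (lt_irrefl _)) (fun i _ => ?_) i
      simpa using hb i
    · exact absurd hi (not_lt.2 (Fin.le_last i))

theorem isContracted_snoc_of_le {m r n : ℕ} {b : Fin n → ℕ} {t : ℕ} :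
    IsContracted m r (Fin.snoc b (r + t) : Fin (n + 1) → ℕ) ↔ IsContracted m r b ∧ t < n * m := by
  constructor
  · rintro ⟨j, hlt, hj, hgt⟩
    induction j using Fin.lastCases with
    | last => simp at hj
    | cast j =>
      refine ⟨⟨j, fun i hi => ?_, by simpa using hj, fun i hi => ?_⟩, ?_⟩
      · simpa using hlt i.castSucc (by simpa using hi)
      · simpa using hgt i.castSucc (by simpa using hi)
      · simpa using (hgt (Fin.last n) (Fin.castSucc_lt_last j)).2
  · rintro ⟨⟨j, hlt, hj, hgt⟩, ht⟩
    refine ⟨j.castSucc, fun i => ?_, by simpa using hj, fun i => ?_⟩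
    · refine Fin.lastCases (fun h => absurd h (not_lt.2 (Fin.le_last _))) (fun i h => ?_) i
      simpa using hlt i (by simpa using h)
    · refine Fin.lastCases (fun _ => by simpa using ht) (fun i h => ?_) i
      simpa using hgt i (by simpa using h)

theorem sum_piFinset_pow_sum {R : Type*} [CommSemiring R] (x : R) (m n : ℕ) :
    ∑ b ∈ Fintype.piFinset fun i : Fin n => range ((i.val + 1) * m), x ^ ∑ i, b i =
      ∏ i ∈ range n, ∑ k ∈ range ((i + 1) * m), x ^ k := by
  rw [← Fin.prod_univ_eq_prod_range (fun i => ∑ k ∈ range ((i + 1) * m), x ^ k) n,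
    Finset.prod_univ_sum]
  simp_rw [Finset.prod_pow_eq_pow_sum]

/-- Write `F_n` for the sum over diagrams with `n` rows and `P_n = ∏_{i≤n} [im]`. Splitting on
whether the last row is shorter than `r` gives `F_{n+1} = P_n [r] + F_n x^r [nm]`. If `F_n = P_{n-1}
[nr]`, this equals `P_n ([r] + x^r [nr]) = P_n [(n+1)r]`. The variable `x` is general so that `x =
1` counts the diagrams and `x = X` gives the series. -/
theorem sum_contractedFinset_pow_sum {R : Type*} [CommSemiring R] (x : R) {m r : ℕ} (hr : r ≤ m)
    (n : ℕ) :
    ∑ a ∈ contractedFinset m r (n + 1), x ^ ∑ i, a i =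
      (∏ i ∈ range n, ∑ k ∈ range ((i + 1) * m), x ^ k) * ∑ k ∈ range ((n + 1) * r), x ^ k := by
  classical
  have key : ∀ n, ∑ a ∈ contractedFinset m r (n + 1), x ^ ∑ i, a i =
      (∏ i ∈ range n, ∑ k ∈ range ((i + 1) * m), x ^ k) * (∑ k ∈ range r, x ^ k) +
        (∑ a ∈ contractedFinset m r n, x ^ ∑ i, a i) * (x ^ r * ∑ k ∈ range (n * m), x ^ k) := by
    intro n
    rw [← sum_filter_add_sum_filter_not _ (fun a => a (Fin.last n) < r)]
    congr 1
    · rw [← sum_piFinset_pow_sum, sum_mul_sum, ← sum_product']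
      refine sum_nbij' (fun a => (Fin.init a, a (Fin.last n))) (fun b => Fin.snoc b.1 b.2)
        ?_ ?_ (by simp) (by simp) ?_
      · intro a ha
        simp only [mem_filter, mem_contractedFinset hr] at ha
        have h := ha.1
        rw [← Fin.snoc_init_self a, isContracted_snoc_of_lt ha.2] at h
        simpa [ha.2, IsSubstaircase] using h
      · rintro ⟨b, t⟩ h
        simp only [mem_product, Fintype.mem_piFinset, mem_range] at h
        simp only [mem_filter, mem_contractedFinset hr, isContracted_snoc_of_lt h.2, Fin.snoc_last]
        exact ⟨h.1, h.2⟩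
      · intro a _
        rw [Fin.sum_univ_castSucc, pow_add]
        rfl
    · rw [mul_sum, sum_mul_sum, ← sum_product']
      refine sum_nbij' (fun a => (Fin.init a, a (Fin.last n) - r)) (fun b => Fin.snoc b.1 (r + b.2))
        ?_ ?_ ?_ (by simp) ?_
      · intro a ha
        simp only [mem_filter, mem_contractedFinset hr, not_lt] at ha
        obtain ⟨t, ht⟩ := Nat.exists_eq_add_of_le ha.2
        have h := ha.1
        rw [← Fin.snoc_init_self a, ht, isContracted_snoc_of_le] at h
        simpa [ht, mem_contractedFinset hr] using h
      · rintro ⟨b, t⟩ h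
        simp only [mem_product, mem_contractedFinset hr, mem_range] at h
        simpa [mem_filter, mem_contractedFinset hr, isContracted_snoc_of_le] using h
      · intro a ha
        simp only [mem_filter, not_lt] at ha
        simp [Nat.add_sub_cancel' ha.2]
      · intro a ha
        simp only [mem_filter, not_lt] at ha
        rw [Fin.sum_univ_castSucc, pow_add, ← pow_add x r, Nat.add_sub_cancel' ha.2]
        rfl
  induction n with
  | zero =>
    -- The second summand vanishes, because `range (0 * m)` is empty.
    rw [key]
    simp
  | succ n ih =>
    rw [key, ih, prod_range_succ, show (n + 1 + 1) * r = r + (n + 1) * r by ring,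
      sum_range_add (fun k => x ^ k)]
    simp_rw [pow_add, ← mul_sum]
    ring

theorem card_contractedFinset {m r : ℕ} (hr : r ≤ m) (n : ℕ) :
    #(contractedFinset m r (n + 1)) = (n + 1).factorial * (m ^ n * r) := by
  have h := sum_contractedFinset_pow_sum (1 : ℕ) hr n
  simp only [one_pow, sum_const, smul_eq_mul, mul_one, card_range, prod_mul_distrib,
    prod_const, prod_range_add_one_eq_factorial] at h
  rw [h, Nat.factorial_succ]
  ring

end ShephardTodd

namespace ShephardTodd

open Finset MvPolynomial

/-! ### Complete homogeneous symmetric functions -/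

section CompleteSum

variable {ι R : Type*} [DecidableEq ι] [CommRing R]

/-- The complete homogeneous symmetric function of degree `d` in the elements `y i`, `i ∈ s`. -/
def completeSum (y : ι → R) (s : Finset ι) (d : ℕ) : R :=
  ∑ a ∈ piAntidiag s d, ∏ i ∈ s, y i ^ a i

theorem completeSum_zero (y : ι → R) (s : Finset ι) : completeSum y s 0 = 1 := by
  simp [completeSum]

theorem completeSum_insert (y : ι → R) {k : ι} {s : Finset ι} (hk : k ∉ s) (d : ℕ) :
    completeSum y (insert k s) d = ∑ e ∈ antidiagonal d, y k ^ e.1 * completeSum y s e.2 := by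
  rw [completeSum, ← cons_eq_insert _ _ hk, piAntidiag_cons hk, sum_disjiUnion]
  refine sum_congr rfl fun e _ => ?_
  rw [sum_map, completeSum, mul_sum]
  refine sum_congr rfl fun a ha => ?_
  have hak : a k = 0 := by
    by_contra h
    exact hk ((mem_piAntidiag.1 ha).2 k h)
  rw [prod_cons]
  congr 1
  · simp [hak]
  · refine prod_congr rfl fun i hi => ?_
    have : i ≠ k := fun h => hk (h ▸ hi)
    simp [this]

/-- Monomials are sorted by whether `y k` divides them. -/
theorem completeSum_insert_succ (y : ι → R) {k : ι} {s : Finset ι} (hk : k ∉ s) (d : ℕ) :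
    completeSum y (insert k s) (d + 1) =
      completeSum y s (d + 1) + y k * completeSum y (insert k s) d := by
  rw [completeSum_insert y hk, completeSum_insert y hk, Nat.sum_antidiagonal_succ, mul_sum]
  simp [pow_succ', mul_assoc]

theorem completeSum_comp_perm [Fintype ι] (y : ι → R) (w : Equiv.Perm ι) (d : ℕ) :
    completeSum (y ∘ w) univ d = completeSum y univ d := by
  refine sum_equiv (Equiv.arrowCongr w (Equiv.refl ℕ)) (fun a => ?_) fun a _ => ?_
  · have h : univ.sum (Equiv.arrowCongr w (Equiv.refl ℕ) a) = univ.sum a :=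
      Equiv.sum_comp w.symm a
    simp [mem_piAntidiag, h]
  · symm
    rw [← Equiv.prod_comp w]
    simp

theorem map_completeSum {S F : Type*} [CommRing S] [FunLike F R S] [RingHomClass F R S] (f : F)
    (y : ι → R) (s : Finset ι) (d : ℕ) :
    f (completeSum y s d) = completeSum (f ∘ y) s d := by
  simp [completeSum, map_sum, map_prod, map_pow]

end CompleteSum

/-! ### Elements of the ideal in the last variables -/

section TailIdeal

variable {R : Type*} [CommRing R] {n : ℕ} {y : Fin n → R} {I : Ideal R}

theorem Ici_eq_insert_of_succ {k k' : Fin n} (h : k'.val = k.val + 1) :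
    Ici k = insert k (Ici k') := by
  ext i
  simp only [mem_Ici, mem_insert, Fin.le_def, Fin.ext_iff, h]
  omega

/-- Induction on `k` through `h_{d+1}(y_{k+1}, …) = h_{d+1}(y_k, …) - y_k h_d(y_k, …)`. Each dropped
variable costs one degree; in the boundary degree `k` the factors `-y_i` accumulate into the signed
product. -/
theorem completeSum_Ici_mem (hI : ∀ d, 0 < d → completeSum y univ d ∈ I) (k : Fin n) :
    (∀ d, k.val < d → completeSum y (Ici k) d ∈ I) ∧
      completeSum y (Ici k) k.val - (-1) ^ k.val * ∏ i ∈ Iio k, y i ∈ I := by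
  obtain ⟨k, hk⟩ := k
  induction k with
  | zero =>
    have h1 : Ici (⟨0, hk⟩ : Fin n) = univ := by
      ext i
      simp [Fin.le_def]
    have h2 : Iio (⟨0, hk⟩ : Fin n) = ∅ := by
      ext i
      simp [Fin.lt_def]
    rw [h1, h2]
    exact ⟨hI, by simp [completeSum_zero]⟩
  | succ k ih =>
    have hk' : k < n := by omega
    obtain ⟨ih1, ih2⟩ := ih hk'
    have hnot : (⟨k, hk'⟩ : Fin n) ∉ Ici (⟨k + 1, hk⟩ : Fin n) := by
      simp [Fin.le_def]
    have hIci : Ici (⟨k, hk'⟩ : Fin n) = insert ⟨k, hk'⟩ (Ici ⟨k + 1, hk⟩) :=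
      Ici_eq_insert_of_succ rfl
    have hrec : ∀ d, completeSum y (Ici (⟨k + 1, hk⟩ : Fin n)) (d + 1) =
        completeSum y (Ici ⟨k, hk'⟩) (d + 1) - y ⟨k, hk'⟩ * completeSum y (Ici ⟨k, hk'⟩) d := by
      intro d
      rw [hIci, completeSum_insert_succ y hnot]
      ring
    constructor
    · intro d hd
      obtain ⟨d, rfl⟩ : ∃ e, d = e + 1 := ⟨d - 1, by simp at hd; omega⟩
      simp only [Nat.add_lt_add_iff_right] at hd
      rw [hrec]
      exact I.sub_mem (ih1 _ (by simp; omega)) (I.mul_mem_left _ (ih1 _ hd))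
    · have hIio : Iio (⟨k + 1, hk⟩ : Fin n) = insert ⟨k, hk'⟩ (Iio ⟨k, hk'⟩) := by
        ext i
        simp only [mem_Iio, mem_insert, Fin.lt_def, Fin.ext_iff]
        omega
      rw [hrec, hIio, prod_insert (by simp)]
      have h := I.sub_mem (ih1 (k + 1) (by simp)) (I.mul_mem_left (y ⟨k, hk'⟩) ih2)
      convert h using 1
      simp only
      ring

/-- Modulo `I` the tail sum is `± ∏_{i<k} x_i^m`. Multiplied by `∏_{i≥k} x_i^r` it becomes divisible
by `∏ x_i^r`, as `r ≤ m`. -/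
theorem prod_Ici_mul_completeSum_mem {x : Fin n → R} {m r : ℕ} (hr : r ≤ m)
    (hI : ∀ d, 0 < d → completeSum (fun i => x i ^ m) univ d ∈ I) (hx : ∏ i, x i ^ r ∈ I)
    (k : Fin n) :
    (∏ i ∈ Ici k, x i ^ r) * completeSum (fun i => x i ^ m) (Ici k) k.val ∈ I := by
  have h := (completeSum_Ici_mem hI k).2
  have h1 : (∏ i ∈ Ici k, x i ^ r) * ∏ i ∈ Iio k, x i ^ m ∈ I := by
    have h2 : (∏ i ∈ Ici k, x i ^ r) * ∏ i ∈ Iio k, x i ^ m =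
        (∏ i ∈ Iio k, x i ^ (m - r)) * ∏ i, x i ^ r := by
      have h3 : (univ : Finset (Fin n)) = Iio k ∪ Ici k := by
        ext i
        simp [lt_or_ge]
      have h4 : Disjoint (Iio k) (Ici k) := by
        rw [disjoint_left]
        intro i
        simp
      rw [h3, prod_union h4, ← mul_assoc, ← prod_mul_distrib]
      simp_rw [← pow_add, Nat.sub_add_cancel hr]
      ring
    rw [h2]
    exact I.mul_mem_left _ hx
  have h2 := I.add_mem (I.mul_mem_left (∏ i ∈ Ici k, x i ^ r) h) (I.mul_mem_left ((-1) ^ k.val) h1)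
  convert h2 using 1
  ring

end TailIdeal

/-! ### The group action and two families of invariants -/

section Action

variable {m p n : ℕ} {K : Subfield ℂ}

theorem exists_act_X_eq (hm : m ≠ 0) {g : GL (Fin n) K}
    (hg : g ∈ reflectionGroupOver K m p n hm) :
    ∃ (w : Equiv.Perm (Fin n)) (c : Fin n → K), (∀ j, c j ^ m = 1) ∧ (∏ j, c j) ^ (m / p) = 1 ∧
      ∀ j, act g (X j) = C (c j) * X (w j) := by
  obtain ⟨w, c, hc, hcp, h⟩ := (reflectionGroupOver K m p n hm).inv_mem hg
  obtain ⟨M, hM⟩ : ∃ M : Matrix (Fin n) (Fin n) K, M = ((g⁻¹ : GL (Fin n) K) : Matrix _ _ K) :=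
    ⟨_, rfl⟩
  have h' : ∀ i j, (M i j : ℂ) = if i = w j then c j else 0 := by
    intro i j
    rw [← h, hM]
    rfl
  have hv : ∀ j, (M (w j) j : ℂ) = c j := fun j => by simp [h']
  -- The action reads rows of `g⁻¹`, whereas `w` and `c` describe its columns; hence `w.symm`.
  refine ⟨w.symm, fun j => M j (w.symm j), fun j => ?_, ?_, fun j => ?_⟩
  · apply Subtype.ext
    have := hv (w.symm j)
    simp only [Equiv.apply_symm_apply] at this
    push_cast
    rw [this, hc]
  · apply Subtype.ext
    rw [← Equiv.prod_comp w]
    simp only [Equiv.symm_apply_apply]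
    push_cast
    simp_rw [hv, hcp]
  · rw [act, aeval_X, ← hM, sum_eq_single (w.symm j)]
    · intro i _ hi
      have : M j i = 0 := by
        apply Subtype.ext
        rw [h', if_neg]
        · rfl
        · rintro rfl
          simp at hi
      rw [this, C_0, zero_mul]
    · simp

/-- The generalized permutation matrix with entry `c j` in row `w j` of column `j`. -/
def pseudoPerm {F : Type*} [Field F] (w : Equiv.Perm (Fin n)) (c : Fin n → Fˣ) : GL (Fin n) F where
  val := Matrix.of fun i j => if i = w j then (c j : F) else 0
  inv := Matrix.of fun i j => if j = w i then ((c i)⁻¹ : Fˣ) else (0 : F)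
  val_inv := by
    ext i j
    rw [Matrix.mul_apply, sum_eq_single (w⁻¹ i)]
    · by_cases h : i = j
      · subst h
        simp
      · simp [Matrix.one_apply_ne h, Ne.symm h]
    · intro k _ hk
      have : i ≠ w k := by
        rintro rfl
        simp at hk
      simp [this]
    · simp
  inv_val := by
    ext i j
    rw [Matrix.mul_apply, sum_eq_single (w i)]
    · by_cases h : i = j
      · subst h
        simp
      · simp [Matrix.one_apply_ne h, h]
    · intro k _ hk
      simp [hk]
    · simp

theorem pseudoPerm_apply {F : Type*} [Field F] (w : Equiv.Perm (Fin n)) (c : Fin n → Fˣ)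
    (i j : Fin n) : pseudoPerm w c i j = if i = w j then (c j : F) else 0 := rfl

/-- The diagonal matrix with entries `c` lies in the group. -/
theorem mem_of_entries_mem (hm : m ≠ 0)
    (hK : ∀ g ∈ reflectionGroup m p n hm, ∀ i j, g i j ∈ K) {c : Fin n → ℂ}
    (hc : ∀ j, c j ^ m = 1) (hcp : (∏ j, c j) ^ (m / p) = 1) (j : Fin n) : c j ∈ K := by
  have hu : ∀ j, c j ≠ 0 := fun j h => by
    have := hc j
    rw [h, zero_pow hm] at this
    exact zero_ne_one this
  have h := hK (pseudoPerm 1 fun j => Units.mk0 (c j) (hu j)) ⟨1, c, hc, hcp, fun i j => rfl⟩ j j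
  simpa [pseudoPerm_apply] using h

theorem exists_mem_act_X_eq (hm : m ≠ 0) (w : Equiv.Perm (Fin n)) {c : Fin n → K}
    (hc : ∀ j, c j ^ m = 1) (hcp : (∏ j, c j) ^ (m / p) = 1) :
    ∃ g ∈ reflectionGroupOver K m p n hm, ∀ j, act g (X j) = C (c j) * X (w j) := by
  have hu : ∀ j, c j ≠ 0 := fun j h => by
    have := hc j
    rw [h, zero_pow hm] at this
    exact zero_ne_one this
  -- Row `j` of `g` has its entry `c j` in column `w j`. The element sought is `g⁻¹`, since the
  -- action inverts.
  set g : GL (Fin n) K := pseudoPerm w⁻¹ fun j => Units.mk0 (c (w⁻¹ j)) (hu _) with hg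
  refine ⟨g⁻¹, Subgroup.inv_mem _ ?_, fun j => ?_⟩
  · refine ⟨w⁻¹, fun j => c (w⁻¹ j), fun j => ?_, ?_, fun i j => ?_⟩
    · change (c (w⁻¹ j) : ℂ) ^ m = 1
      exact_mod_cast congrArg Subtype.val (hc (w⁻¹ j))
    · rw [Equiv.prod_comp w⁻¹ fun j => (c j : ℂ)]
      exact_mod_cast congrArg Subtype.val hcp
    · change ((g i j : K) : ℂ) = _
      rw [hg, pseudoPerm_apply]
      split_ifs <;> rfl
  · rw [act, aeval_X, inv_inv, sum_eq_single (w j)]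
    · simp [hg, pseudoPerm_apply]
    · intro i _ hi
      have : j ≠ w⁻¹ i := by
        rintro rfl
        simp at hi
      rw [hg, pseudoPerm_apply, if_neg this, C_0, zero_mul]
    · simp

theorem completeSum_mem_coinvariantIdeal (hm : m ≠ 0) {d : ℕ} (hd : 0 < d) :
    completeSum (fun i => (X i : MvPolynomial (Fin n) K) ^ m) univ d ∈
      coinvariantIdeal (reflectionGroupOver K m p n hm) := by
  refine Ideal.subset_span ⟨fun g hg => ?_, m * d, by positivity, ?_⟩
  · obtain ⟨w, c, hc, -, h⟩ := exists_act_X_eq hm hg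
    rw [map_completeSum, ← completeSum_comp_perm (fun i => (X i : MvPolynomial (Fin n) K) ^ m) w]
    congr 1
    funext j
    simp only [Function.comp_apply, map_pow, h, mul_pow]
    rw [← C_pow, hc, C_1, one_mul]
  · refine IsHomogeneous.sum _ _ _ fun a ha => ?_
    rw [← (mem_piAntidiag.1 ha).1, mul_sum]
    refine IsHomogeneous.prod _ _ _ fun i _ => ?_
    rw [← pow_mul]
    exact isHomogeneous_X_pow i _

theorem prod_X_pow_mem_coinvariantIdeal (hm : m ≠ 0) (hp : p ∣ m) (hn : 1 ≤ n) :
    ∏ i, (X i : MvPolynomial (Fin n) K) ^ (m / p) ∈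
      coinvariantIdeal (reflectionGroupOver K m p n hm) := by
  have hr : 0 < m / p := Nat.div_pos (Nat.le_of_dvd (Nat.pos_of_ne_zero hm) hp)
    (Nat.pos_of_dvd_of_pos hp (Nat.pos_of_ne_zero hm))
  refine Ideal.subset_span ⟨fun g hg => ?_, ∑ _i : Fin n, m / p, ?_, ?_⟩
  · obtain ⟨w, c, -, hc, h⟩ := exists_act_X_eq hm hg
    simp only [map_prod, map_pow, h, mul_pow]
    rw [prod_mul_distrib, prod_pow, ← map_prod, ← C_pow, hc, C_1, one_mul,
      Equiv.prod_comp w fun i => (X i : MvPolynomial (Fin n) K) ^ (m / p)]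
  · simp only [sum_const, card_univ, Fintype.card_fin, smul_eq_mul]
    positivity
  · exact IsHomogeneous.prod _ _ _ fun i _ => isHomogeneous_X_pow i _

end Action

end ShephardTodd

namespace ShephardTodd

open Finset MvPolynomial

/-! ### Spanning by lexicographic reduction -/

section Spanning

variable {K : Type*} [Field K] {n m r : ℕ}

/-- The monomial with exponents `a`. -/
noncomputable def mono (K : Type*) [Field K] {n : ℕ} (a : Fin n → ℕ) : MvPolynomial (Fin n) K :=
  ∏ i, X i ^ a i

theorem mono_add (a b : Fin n → ℕ) : mono K (a + b) = mono K a * mono K b := by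
  simp [mono, pow_add, prod_mul_distrib]

theorem mono_eq_monomial (a : Fin n → ℕ) :
    mono K a = monomial (Finsupp.equivFunOnFinite.symm a) 1 := by
  rw [monomial_eq, C_1, one_mul, Finsupp.prod_fintype _ _ fun i => pow_zero _]
  rfl

theorem mono_injective : Function.Injective (mono K : (Fin n → ℕ) → _) := by
  intro a b h
  rw [mono_eq_monomial, mono_eq_monomial] at h
  exact Finsupp.equivFunOnFinite.symm.injective (monomial_left_injective one_ne_zero h)

theorem isHomogeneous_mono (a : Fin n → ℕ) : (mono K a).IsHomogeneous (∑ i, a i) :=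
  IsHomogeneous.prod _ _ _ fun i _ => isHomogeneous_X_pow i _

theorem mono_ne_zero (a : Fin n → ℕ) : mono K a ≠ 0 := by
  rw [mono_eq_monomial]
  simp

theorem totalDegree_mono (a : Fin n → ℕ) : (mono K a).totalDegree = ∑ i, a i :=
  (isHomogeneous_mono a).totalDegree (mono_ne_zero a)

theorem prod_X_pow_eq_mono (s : Finset (Fin n)) (m : ℕ) {a : Fin n → ℕ}
    (ha : ∀ i, a i ≠ 0 → i ∈ s) : ∏ i ∈ s, ((X i : MvPolynomial (Fin n) K) ^ m) ^ a i =
      mono K (m • a) := by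
  rw [mono, ← prod_subset (subset_univ s)]
  · simp [pow_mul]
  · intro i _ hi
    have : a i = 0 := by
      by_contra h
      exact hi (ha i h)
    simp [this]

/-- Among the terms of `mono K c * h_e(x_k^m, …)`, the one putting all of `e` on `x_k` is
lexicographically largest: exponents before `k` agree, and any other term has a smaller exponent at
`k`. Modulo `I` it is thus a combination of smaller monomials of the same degree. -/
theorem mono_mem_of_lex_lt {I : Ideal (MvPolynomial (Fin n) K)}
    {W : Submodule K (MvPolynomial (Fin n) K)} (hIW : I.restrictScalars K ≤ W) (k : Fin n) (e : ℕ)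
    (c : Fin n → ℕ)
    (hc : mono K c * completeSum (fun i => (X i : MvPolynomial (Fin n) K) ^ m) (Ici k) e ∈ I)
    (hm : 0 < m)
    (hW : ∀ b : Fin n → ℕ, toLex b < toLex (c + m • Pi.single k e) →
      ∑ i, b i = ∑ i, (c + m • Pi.single k e : Fin n → ℕ) i → mono K b ∈ W) :
    mono K (c + m • Pi.single k e) ∈ W := by
  have hk : Pi.single k e ∈ piAntidiag (Ici k) e := by
    rw [mem_piAntidiag]
    constructor
    · rw [sum_pi_single']
      simp
    · intro i hi
      by_contra h
      have : i ≠ k := by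
        rintro rfl
        simp at h
      simp [this] at hi
  have hsum : mono K c * completeSum (fun i => (X i : MvPolynomial (Fin n) K) ^ m) (Ici k) e =
      ∑ a ∈ piAntidiag (Ici k) e, mono K (c + m • a) := by
    rw [completeSum, mul_sum]
    refine sum_congr rfl fun a ha => ?_
    rw [prod_X_pow_eq_mono _ _ (mem_piAntidiag.1 ha).2, mono_add]
  rw [hsum, ← add_sum_erase _ _ hk] at hc
  have hrest : ∑ a ∈ (piAntidiag (Ici k) e).erase (Pi.single k e), mono K (c + m • a) ∈ W := by
    refine W.sum_mem fun a ha => ?_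
    obtain ⟨hne, ha⟩ := mem_erase.1 ha
    obtain ⟨hs, hsupp⟩ := mem_piAntidiag.1 ha
    have hsu : ∑ i, a i = e := by
      rw [← hs]
      symm
      refine sum_subset (subset_univ _) fun i _ hi => ?_
      by_contra h
      exact hi (hsupp i h)
    have hlow : ∀ i, i < k → a i = 0 := fun i hi => by
      by_contra h
      exact absurd (mem_Ici.1 (hsupp i h)) (not_le.2 hi)
    have hak : a k < e := by
      have h1 := add_sum_erase univ a (mem_univ k)
      rw [hsu] at h1
      refine lt_of_le_of_ne (by omega) fun h => hne ?_
      have h2 : ∑ i ∈ univ.erase k, a i = 0 := by omega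
      funext i
      by_cases hi : i = k
      · subst hi
        simp [h]
      · rw [Pi.single_eq_of_ne hi]
        exact sum_eq_zero_iff.1 h2 i (by simp [hi])
    refine hW _ ⟨k, fun i hi => ?_, ?_⟩ ?_
    · simp [hlow i hi, hi.ne]
    · simpa using Nat.mul_lt_mul_of_pos_left hak hm
    · simp [sum_add_distrib, ← mul_sum, hsu]
  have := W.sub_mem (hIW hc) hrest
  simpa using this

/-- If no row is shorter than `r`, then `k = 0` works. Otherwise the last such row is a candidate
for the distinguished row, and its failure exhibits a later row that is too long. -/
theorem exists_of_not_isContracted (hn : 1 ≤ n) {a : Fin n → ℕ} (ha : IsSubstaircase m a)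
    (hna : ¬ IsContracted m r a) : ∃ k : Fin n, (∀ i, k ≤ i → r ≤ a i) ∧ r + k.val * m ≤ a k := by
  classical
  by_cases hall : ∀ i, r ≤ a i
  · exact ⟨⟨0, hn⟩, fun i _ => hall i, by simpa using hall _⟩
  · push Not at hall
    obtain ⟨j, hj, hmax⟩ : ∃ j : Fin n, a j < r ∧ ∀ l, j < l → r ≤ a l := by
      have hne : (univ.filter fun i => a i < r).Nonempty := by
        obtain ⟨i, hi⟩ := hall
        exact ⟨i, by simpa using hi⟩
      refine ⟨(univ.filter fun i => a i < r).max' hne, ?_, fun l hl => ?_⟩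
      · simpa using (univ.filter fun i => a i < r).max'_mem hne
      · by_contra h
        exact absurd hl (not_lt.2 (le_max' _ _ (by simpa using h)))
    by_contra hno
    push Not at hno
    refine hna ⟨j, fun i _ => ha i, hj, fun i hi => ⟨hmax i hi, ?_⟩⟩
    have h1 := hno i fun l hl => hmax l (hi.trans_le hl)
    have h2 := hmax i hi
    omega

theorem mono_mem_span_sup (hn : 1 ≤ n) (hm : 0 < m) (hr : r ≤ m)
    {I : Ideal (MvPolynomial (Fin n) K)}
    (hI : ∀ d, 0 < d → completeSum (fun i => (X i : MvPolynomial (Fin n) K) ^ m) univ d ∈ I)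
    (hx : ∏ i, (X i : MvPolynomial (Fin n) K) ^ r ∈ I) (a : Fin n → ℕ) :
    mono K a ∈ Submodule.span K (mono K '' {b | IsContracted m r b ∧ ∑ i, b i = ∑ i, a i}) ⊔
      I.restrictScalars K := by
  -- The lexicographic order on finitely many natural exponents is well-founded; fixing the degree
  -- serves only to keep the result graded.
  have hwf : WellFounded fun a b : Fin n → ℕ => toLex a < toLex b :=
    InvImage.wf toLex wellFounded_lt
  induction a using hwf.induction with
  | _ a ih =>
  set W := Submodule.span K (mono K '' {b | IsContracted m r b ∧ ∑ i, b i = ∑ i, a i}) ⊔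
      I.restrictScalars K with hW
  have ih' : ∀ b : Fin n → ℕ, toLex b < toLex a → ∑ i, b i = ∑ i, a i → mono K b ∈ W := by
    intro b hb hs
    have := ih b hb
    rwa [hs] at this
  have hsplit : ∀ (k : Fin n) (e : ℕ), m * e ≤ a k →
      (a - m • Pi.single k e) + m • Pi.single k e = a := by
    intro k e h
    funext i
    by_cases hi : i = k
    · subst hi
      simp [Nat.sub_add_cancel h]
    · simp [hi]
  have hred : ∀ (k : Fin n) (e : ℕ), m * e ≤ a k → mono K (a - m • Pi.single k e) *
      completeSum (fun i => (X i : MvPolynomial (Fin n) K) ^ m) (Ici k) e ∈ I → mono K a ∈ W := by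
    intro k e h hmem
    have := mono_mem_of_lex_lt (W := W) le_sup_right k e _ hmem hm
    rw [hsplit k e h] at this
    exact this ih'
  by_cases hsub : IsSubstaircase m a
  · by_cases hcon : IsContracted m r a
    · exact Submodule.mem_sup_left (Submodule.subset_span ⟨a, ⟨hcon, rfl⟩, rfl⟩)
    · obtain ⟨k, hk1, hk2⟩ := exists_of_not_isContracted hn hsub hcon
      refine hred k k.val (by rw [mul_comm]; omega) ?_
      -- Indicator of the tail: `r • b` is the exponent of `∏_{i≥k} x_i^r`, which still divides the
      -- monomial after `x_k^{km}` is removed.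
      set b : Fin n → ℕ := fun i => if k ≤ i then 1 else 0 with hb
      have h1 : ∏ i ∈ Ici k, (X i : MvPolynomial (Fin n) K) ^ r = mono K (r • b) := by
        rw [← prod_X_pow_eq_mono (Ici k) r (a := b) (by simp [hb])]
        refine prod_congr rfl fun i hi => ?_
        simp [hb, mem_Ici.1 hi]
      have h2 : a - m • Pi.single k k.val =
          (a - m • Pi.single k k.val - r • b) + r • b := by
        funext i
        by_cases hi : k ≤ i
        · have h3 : r ≤ a i - m * (Pi.single k k.val : Fin n → ℕ) i := by
            by_cases hik : i = k
            · subst hik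
              simp only [Pi.single_eq_same]
              rw [mul_comm]
              omega
            · simpa [hik] using hk1 i hi
          simp [hb, hi, Nat.sub_add_cancel h3]
        · simp [hb, hi]
      rw [h2, mono_add, ← h1, mul_assoc]
      exact I.mul_mem_left _ (prod_Ici_mul_completeSum_mem hr hI hx k)
  · simp only [IsSubstaircase, not_forall, not_lt] at hsub
    obtain ⟨k, hk⟩ := hsub
    exact hred k (k.val + 1) (by rwa [mul_comm])
      (I.mul_mem_left _ ((completeSum_Ici_mem hI k).1 _ (Nat.lt_succ_self _)))

theorem mem_span_sup_of_isHomogeneous (hn : 1 ≤ n) (hm : 0 < m) (hr : r ≤ m)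
    {I : Ideal (MvPolynomial (Fin n) K)}
    (hI : ∀ d, 0 < d → completeSum (fun i => (X i : MvPolynomial (Fin n) K) ^ m) univ d ∈ I)
    (hx : ∏ i, (X i : MvPolynomial (Fin n) K) ^ r ∈ I) {f : MvPolynomial (Fin n) K} {d : ℕ}
    (hf : f.IsHomogeneous d) :
    f ∈ Submodule.span K (mono K '' {b | IsContracted m r b ∧ ∑ i, b i = d}) ⊔
      I.restrictScalars K := by
  rw [f.as_sum]
  refine Submodule.sum_mem _ fun s hs => ?_
  have h1 : monomial s (coeff s f) = coeff s f • mono K s := by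
    rw [mono_eq_monomial, smul_monomial, smul_eq_mul, mul_one]
    congr
    ext
    rfl
  have h2 : ∑ i, s i = d := by
    rw [hf.degree_eq_sum_deg_support hs, ← Finsupp.sum_fintype s (fun _ x => x) fun _ => rfl]
    rfl
  rw [h1]
  refine Submodule.smul_mem _ _ ?_
  have := mono_mem_span_sup hn hm hr hI hx s
  rwa [h2] at this

end Spanning

end ShephardTodd

namespace ShephardTodd

open Finset MvPolynomial

/-! ### Enough distinct points in one orbit -/

section Orbit

theorem exists_pseudoPerm_family (n : ℕ) {m r : ℕ} (hm : m ≠ 0) (hr : r ∣ m) :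
    ∃ (T : Type) (_ : Fintype T) (w : T → Equiv.Perm (Fin (n + 1))) (c : T → Fin (n + 1) → ℂ),
      Fintype.card T = (n + 1).factorial * (m ^ n * r) ∧ (∀ t j, c t j ^ m = 1) ∧
      (∀ t, (∏ j, c t j) ^ r = 1) ∧ Function.Injective fun t => (w t, c t) := by
  have hr0 : r ≠ 0 := by
    rintro rfl
    exact hm (Nat.eq_zero_of_zero_dvd hr)
  have : NeZero m := ⟨hm⟩
  have : NeZero r := ⟨hr0⟩
  have : Fintype (rootsOfUnity m ℂ) := Fintype.ofFinite _
  have : Fintype (rootsOfUnity r ℂ) := Fintype.ofFinite _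
  let T := Equiv.Perm (Fin (n + 1)) × (Fin n → rootsOfUnity m ℂ) × rootsOfUnity r ℂ
  -- All entries but the first are free; the first makes the product equal to the chosen `r`-th root
  -- of unity. It is an `m`-th root because `r ∣ m`.
  let u : T → Fin (n + 1) → ℂˣ := fun t =>
    Fin.cons ((t.2.2 : ℂˣ) * ∏ j, (t.2.1 j : ℂˣ)⁻¹) fun j => (t.2.1 j : ℂˣ)
  have hd : ∀ (t : T) j, (t.2.1 j : ℂˣ) ^ m = 1 := fun t j => (mem_rootsOfUnity _ _).1 (t.2.1 j).2
  have hz : ∀ t : T, (t.2.2 : ℂˣ) ^ r = 1 := fun t => (mem_rootsOfUnity _ _).1 t.2.2.2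
  have huprod : ∀ t, ∏ j, u t j = t.2.2 := by
    intro t
    simp [u, Fin.prod_univ_succ]
  have hupow : ∀ t j, u t j ^ m = 1 := by
    intro t j
    refine Fin.cases ?_ (fun j => ?_) j
    · have hzm : (t.2.2 : ℂˣ) ^ m = 1 := by
        obtain ⟨q, hq⟩ := hr
        exact (congrArg _ hq).trans (by rw [pow_mul, hz, one_pow])
      simp [u, mul_pow, ← prod_pow, hd, hzm]
    · simpa [u] using hd t j
  refine ⟨T, inferInstance, fun t => t.1, fun t j => (u t j : ℂ), ?_, ?_, ?_, ?_⟩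
  · have h1 : Fintype.card (rootsOfUnity m ℂ) = m := by
      rw [← Nat.card_eq_fintype_card, Complex.card_rootsOfUnity]
    have h2 : Fintype.card (rootsOfUnity r ℂ) = r := by
      rw [← Nat.card_eq_fintype_card, Complex.card_rootsOfUnity]
    simp [T, Fintype.card_perm, h1, h2]
  · intro t j
    simpa using congrArg Units.val (hupow t j)
  · intro t
    simpa using congrArg Units.val ((congrArg (· ^ r) (huprod t)).trans (hz t))
  · intro t t' h
    simp only [Prod.mk.injEq] at h
    have hu : u t = u t' := funext fun j => Units.ext (congrFun h.2 j)
    refine Prod.ext h.1 (Prod.ext (funext fun j => Subtype.ext ?_) (Subtype.ext ?_))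
    · simpa [u] using congrFun hu j.succ
    · rw [← huprod, ← huprod, hu]

theorem exists_orbit (n : ℕ) {m p : ℕ} (hm : m ≠ 0) (hp : p ∣ m) {K : Subfield ℂ}
    (hK : ∀ g ∈ reflectionGroup m p (n + 1) hm, ∀ i j, g i j ∈ K) :
    ∃ (T : Type) (_ : Fintype T) (v : Fin (n + 1) → K) (x : T → Fin (n + 1) → K),
      Fintype.card T = (n + 1).factorial * (m ^ n * (m / p)) ∧ Function.Injective x ∧
      ∀ t, ∃ g ∈ reflectionGroupOver K m p (n + 1) hm, ∀ f, aeval (x t) f = aeval v (act g f) := by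
  obtain ⟨T, _, w, c, hcard, hc, hcp, hinj⟩ :=
    exists_pseudoPerm_family n hm (Nat.div_dvd_of_dvd hp)
  let c' : T → Fin (n + 1) → K := fun t j => ⟨c t j, mem_of_entries_mem hm hK (hc t) (hcp t) j⟩
  have hc' : ∀ t j, (c' t j : ℂ) = c t j := fun t j => rfl
  -- Coordinates with distinct nonzero absolute values: norms recover the permutation, and
  -- cancelling then recovers the roots of unity.
  let v : Fin (n + 1) → K := fun j => ((j.val + 1 : ℕ) : K)
  refine ⟨T, inferInstance, v, fun t j => c' t j * v (w t j), hcard, ?_, fun t => ?_⟩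
  · intro t t' h
    have h1 : ∀ j, c t j * ((w t j).val + 1 : ℕ) = c t' j * ((w t' j).val + 1 : ℕ) := fun j => by
      have := congrArg Subtype.val (congrFun h j)
      simpa [v, hc'] using this
    have h2 : ∀ j, w t j = w t' j := fun j => by
      have h3 := congrArg norm (h1 j)
      rw [norm_mul, norm_mul, Complex.norm_eq_one_of_pow_eq_one (hc t j) hm,
        Complex.norm_eq_one_of_pow_eq_one (hc t' j) hm, one_mul, one_mul, Complex.norm_natCast,
        Complex.norm_natCast] at h3
      have h4 : (w t j).val + 1 = (w t' j).val + 1 := by exact_mod_cast h3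
      exact Fin.ext (by omega)
    refine hinj (Prod.ext (Equiv.ext h2) (funext fun j => ?_))
    have h3 := h1 j
    rw [h2] at h3
    exact mul_right_cancel₀ (Nat.cast_ne_zero.2 (Nat.succ_ne_zero _)) h3
  · obtain ⟨g, hg, hact⟩ := exists_mem_act_X_eq (m := m) (p := p) (K := K) hm (w t) (c := c' t)
      (fun j => Subtype.ext (by push_cast; exact hc t j))
      (Subtype.ext (by push_cast; exact hcp t))
    refine ⟨g, hg, fun f => ?_⟩
    have : (aeval fun j => c' t j * v (w t j) : MvPolynomial (Fin (n + 1)) K →ₐ[K] K) =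
        (aeval v).comp (act g) := by
      ext j
      simp [hact]
    rw [this]
    rfl

end Orbit

/-! ### Functions on the orbit -/

section Evaluation

variable {K : Type*} [Field K] {n : ℕ} {T : Type*}

/-- Evaluation of polynomials at a family of points. -/
noncomputable def evalAt (x : T → Fin n → K) : MvPolynomial (Fin n) K →ₐ[K] (T → K) :=
  AlgHom.pi fun t => aeval (x t)

theorem evalAt_apply (x : T → Fin n → K) (f : MvPolynomial (Fin n) K) (t : T) :
    evalAt x f t = aeval (x t) f := rfl

theorem evalAt_surjective [Finite T] {x : T → Fin n → K} (hx : Function.Injective x) :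
    Function.Surjective (evalAt x) := by
  classical
  -- Interpolation by linear factors; taking `1` when `s = t` lets the product run over all `s`.
  have hsep : ∀ t s : T, ∃ q : MvPolynomial (Fin n) K, aeval (x t) q ≠ 0 ∧
      (s ≠ t → aeval (x s) q = 0) := by
    intro t s
    by_cases h : s = t
    · exact ⟨1, by simp, fun h' => absurd h h'⟩
    · obtain ⟨i, hi⟩ : ∃ i, x t i ≠ x s i := by
        by_contra hno
        push Not at hno
        exact h (hx (funext hno)).symm
      exact ⟨X i - C (x s i), by simpa [sub_eq_zero] using hi, fun _ => by simp⟩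
  choose q hq1 hq2 using hsep
  have := Fintype.ofFinite T
  obtain ⟨Q, hQ⟩ : ∃ Q : T → MvPolynomial (Fin n) K, ∀ t, aeval (x t) (Q t) ≠ 0 ∧
      ∀ s, s ≠ t → aeval (x s) (Q t) = 0 := by
    refine ⟨fun t => ∏ s, q t s, fun t => ⟨?_, fun s hs => ?_⟩⟩
    · rw [map_prod]
      exact prod_ne_zero_iff.2 fun s _ => hq1 t s
    · rw [map_prod]
      exact prod_eq_zero (mem_univ s) (hq2 t s hs)
  intro f
  refine ⟨∑ t, C (f t * (aeval (x t) (Q t))⁻¹) * Q t, funext fun u => ?_⟩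
  rw [evalAt_apply, map_sum, sum_eq_single u]
  · rw [map_mul, algHom_C, Algebra.algebraMap_self, RingHom.id_apply,
      inv_mul_cancel_right₀ (hQ u).1]
  · intro t _ htu
    rw [map_mul, (hQ t).2 u htu.symm, mul_zero]
  · simp

theorem homogeneousComponent_mul_of_isHomogeneous (f : MvPolynomial (Fin n) K)
    {g : MvPolynomial (Fin n) K} {e : ℕ} (hg : g.IsHomogeneous e) (d : ℕ) :
    homogeneousComponent d (f * g) = if e ≤ d then homogeneousComponent (d - e) f * g else 0 := by
  have h : ∀ k, homogeneousComponent d (homogeneousComponent k f * g) =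
      if d = k + e then homogeneousComponent k f * g else 0 := fun k =>
    homogeneousComponent_of_mem ((homogeneousComponent_isHomogeneous k f).mul hg)
  conv_lhs => rw [← sum_homogeneousComponent f, sum_mul, map_sum]
  simp_rw [h]
  split_ifs with hed
  · have h2 : ∀ k, d = k + e ↔ d - e = k := fun k => by omega
    simp_rw [h2]
    rw [sum_ite_eq]
    split_ifs with hk
    · rfl
    · rw [homogeneousComponent_eq_zero _ _ (by simp at hk; omega), zero_mul]
  · exact sum_eq_zero fun k _ => if_neg (by omega)

theorem homogeneousComponent_mem_span {s : Set (MvPolynomial (Fin n) K)}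
    (hs : ∀ f ∈ s, ∃ d, f.IsHomogeneous d) {f : MvPolynomial (Fin n) K}
    (hf : f ∈ Submodule.span K s) (d : ℕ) : homogeneousComponent d f ∈ Submodule.span K s := by
  induction hf using Submodule.span_induction with
  | mem f hf =>
    obtain ⟨e, he⟩ := hs f hf
    rw [homogeneousComponent_of_mem he]
    split_ifs
    · exact Submodule.subset_span hf
    · exact Submodule.zero_mem _
  | zero => simp
  | add f g _ _ h1 h2 =>
    rw [map_add]
    exact Submodule.add_mem _ h1 h2
  | smul c f _ h =>
    rw [map_smul]
    exact Submodule.smul_mem _ c h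

/-- Homogeneous polynomials spanning the coinvariant algebra span the functions on an orbit. -/
theorem map_evalAt_span_eq_top [Finite T] {G : Subgroup (GL (Fin n) K)} {x : T → Fin n → K} {v : Fin n → K}
    (hx : Function.Injective x)
    (horb : ∀ t, ∃ g ∈ G, ∀ f, aeval (x t) f = aeval v (act g f))
    {s : Set (MvPolynomial (Fin n) K)} (hs : ∀ f ∈ s, ∃ d, f.IsHomogeneous d)
    (hspan : ∀ f, ∃ f' ∈ Submodule.span K s, f - f' ∈ coinvariantIdeal G) :
    (Submodule.span K s).map (evalAt x).toLinearMap = ⊤ := by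
  set W := (Submodule.span K s).map (evalAt x).toLinearMap with hW
  have hhom : ∀ d f, f.IsHomogeneous d → evalAt x f ∈ W := by
    intro d
    induction d using Nat.strong_induction_on with
    | _ d ih =>
    have hideal : ∀ f ∈ coinvariantIdeal G, evalAt x (homogeneousComponent d f) ∈ W := by
      intro f hf
      obtain ⟨l, rfl⟩ := (Finsupp.mem_span_iff_linearCombination _ _ _).1 hf
      rw [Finsupp.linearCombination_apply, Finsupp.sum, map_sum, map_sum]
      refine W.sum_mem fun g _ => ?_
      obtain ⟨g, hinv, e, he, hg⟩ := g
      rw [smul_eq_mul, homogeneousComponent_mul_of_isHomogeneous _ hg]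
      split_ifs with hed
      -- An invariant `g` is constant on the points, so multiplying by it only rescales the values
      -- of a polynomial of degree `d - e < d`, to which induction applies.
      · have hconst : evalAt x g = algebraMap K (T → K) (aeval v g) := funext fun t => by
          obtain ⟨σ, hσ, h⟩ := horb t
          rw [evalAt_apply, h, hinv σ hσ]
          rfl
        rw [map_mul, hconst, mul_comm, ← Algebra.smul_def]
        exact W.smul_mem _ (ih (d - e) (by omega) _ (homogeneousComponent_isHomogeneous _ _))
      · rw [map_zero]
        exact W.zero_mem
    intro f hf
    obtain ⟨f', hf', hsub⟩ := hspan f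
    -- `f'` need not be homogeneous, but its degree `d` component stays in the span because `s`
    -- consists of homogeneous elements.
    have h1 : f = homogeneousComponent d f' + homogeneousComponent d (f - f') := by
      rw [← map_add, add_sub_cancel, homogeneousComponent_eq_self hf]
    rw [h1, map_add]
    exact W.add_mem (Submodule.mem_map_of_mem (homogeneousComponent_mem_span hs hf' d))
      (hideal _ hsub)
  rw [eq_top_iff]
  intro φ _
  obtain ⟨f, rfl⟩ := evalAt_surjective hx φ
  rw [← sum_homogeneousComponent f, map_sum]
  exact W.sum_mem fun d _ => hhom d _ (homogeneousComponent_isHomogeneous _ _)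

end Evaluation

end ShephardTodd

namespace ShephardTodd

open Finset MvPolynomial

/-! ### From spanning and independence to graded dimensions -/

section Basis

theorem coinvariantIdeal_spanning (n : ℕ) {m p : ℕ} (hm : m ≠ 0) (hp : p ∣ m) (K : Subfield ℂ)
    {f : MvPolynomial (Fin (n + 1)) K} {d : ℕ} (hf : f.IsHomogeneous d) :
    f ∈ Submodule.span K (mono K '' {b | IsContracted m (m / p) b ∧ ∑ i, b i = d}) ⊔
      (coinvariantIdeal (reflectionGroupOver K m p (n + 1) hm)).restrictScalars K :=
  mem_span_sup_of_isHomogeneous (by omega) (Nat.pos_of_ne_zero hm) (Nat.div_le_self m p)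
    (fun _ hd => completeSum_mem_coinvariantIdeal hm hd)
    (prod_X_pow_mem_coinvariantIdeal hm hp (by omega)) hf

variable {K : Type*} [Field K] {n : ℕ}

theorem exists_mem_sub_mem {I : Ideal (MvPolynomial (Fin n) K)}
    {S : Submodule K (MvPolynomial (Fin n) K)} {f : MvPolynomial (Fin n) K}
    (hf : Ideal.Quotient.mk I f ∈ S.map (Ideal.Quotient.mkₐ K I).toLinearMap) :
    ∃ f' ∈ S, f - f' ∈ I := by
  obtain ⟨f', hf', h⟩ := hf
  exact ⟨f', hf', Ideal.Quotient.eq.1 h.symm⟩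

theorem mk_mem_map_of_mem_sup {I : Ideal (MvPolynomial (Fin n) K)}
    {S : Submodule K (MvPolynomial (Fin n) K)} {f : MvPolynomial (Fin n) K}
    (hf : f ∈ S ⊔ I.restrictScalars K) :
    Ideal.Quotient.mk I f ∈ S.map (Ideal.Quotient.mkₐ K I).toLinearMap := by
  obtain ⟨s, hs, i, hi, rfl⟩ := Submodule.mem_sup.1 hf
  refine ⟨s, hs, Ideal.Quotient.eq.2 ?_⟩
  rw [sub_add_cancel_left]
  exact I.neg_mem hi

theorem finrank_gradedPiece_eq_card {G : Subgroup (GL (Fin n) K)} {d : ℕ}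
    {S : Finset (Fin n → ℕ)} (hS : ∀ a ∈ S, ∑ i, a i = d)
    (hli : LinearIndependent K fun a : S => Ideal.Quotient.mk (coinvariantIdeal G) (mono K a.1))
    (hspan : ∀ f : MvPolynomial (Fin n) K, f.IsHomogeneous d →
      f ∈ Submodule.span K (mono K '' (S : Set (Fin n → ℕ))) ⊔
        (coinvariantIdeal G).restrictScalars K) :
    Module.finrank K (gradedPiece G d) = #S := by
  have h : gradedPiece G d = Submodule.span K (Set.range fun a : S =>
      Ideal.Quotient.mk (coinvariantIdeal G) (mono K a.1)) := by
    apply le_antisymm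
    · rintro _ ⟨f, hf, rfl⟩
      have h := mk_mem_map_of_mem_sup (hspan f hf)
      rw [Submodule.map_span] at h
      refine Submodule.span_mono ?_ h
      rintro _ ⟨_, ⟨a, ha, rfl⟩, rfl⟩
      exact ⟨⟨a, ha⟩, rfl⟩
    · rw [Submodule.span_le]
      rintro _ ⟨⟨a, ha⟩, rfl⟩
      have h := isHomogeneous_mono (K := K) a
      rw [hS a ha] at h
      exact ⟨mono K a, h, rfl⟩
  rw [h, finrank_span_eq_card hli, Fintype.card_coe]

theorem linearIndependent_subset {M ι : Type*} [AddCommGroup M] [Module K M] (v : ι → M)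
    {S T : Finset ι} (hST : S ⊆ T) (h : LinearIndependent K fun a : T => v a.1) :
    LinearIndependent K fun a : S => v a.1 :=
  LinearIndepOn.mono (s := (T : Set ι)) (t := (S : Set ι)) h hST

theorem hilbertSeries_eq_mk_card {G : Subgroup (GL (Fin n) K)} {S : Finset (Fin n → ℕ)}
    (hli : LinearIndependent K fun a : S => Ideal.Quotient.mk (coinvariantIdeal G) (mono K a.1))
    (hspan : ∀ (d : ℕ) (f : MvPolynomial (Fin n) K), f.IsHomogeneous d →
      f ∈ Submodule.span K (mono K '' {b | b ∈ S ∧ ∑ i, b i = d}) ⊔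
        (coinvariantIdeal G).restrictScalars K) :
    hilbertSeries G = PowerSeries.mk fun d => (#{a ∈ S | ∑ i, a i = d} : ℤ) := by
  rw [hilbertSeries]
  congr 1
  funext d
  have hli' : LinearIndependent K fun a : ({a ∈ S | ∑ i, a i = d} : Finset _) =>
      Ideal.Quotient.mk (coinvariantIdeal G) (mono K a.1) :=
    linearIndependent_subset (fun a => Ideal.Quotient.mk (coinvariantIdeal G) (mono K a))
      (filter_subset _ S) hli
  rw [finrank_gradedPiece_eq_card (fun a ha => (mem_filter.1 ha).2) hli']
  intro f hf
  rw [coe_filter]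
  exact hspan d f hf

end Basis

/-! ### Dimension count and conclusion -/

section Main

variable {n m p : ℕ} {K : Subfield ℂ}

theorem top_le_span_mk_mono (hm : m ≠ 0) (hp : p ∣ m) :
    ⊤ ≤ Submodule.span K (Set.range fun a : contractedFinset m (m / p) (n + 1) =>
      Ideal.Quotient.mk (coinvariantIdeal (reflectionGroupOver K m p (n + 1) hm))
        (mono K a.1)) := by
  intro f _
  obtain ⟨f, rfl⟩ := Ideal.Quotient.mk_surjective f
  rw [← sum_homogeneousComponent f, map_sum]
  refine Submodule.sum_mem _ fun d _ => ?_
  have h := mk_mem_map_of_mem_sup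
    (coinvariantIdeal_spanning n hm hp K (homogeneousComponent_isHomogeneous d f))
  rw [Submodule.map_span] at h
  refine Submodule.span_mono ?_ h
  rintro _ ⟨_, ⟨a, ⟨ha, -⟩, rfl⟩, rfl⟩
  exact ⟨⟨a, (mem_contractedFinset (Nat.div_le_self m p)).2 ha⟩, rfl⟩

theorem linearIndependent_mk_mono (hm : m ≠ 0) (hp : p ∣ m)
    (hK : ∀ g ∈ reflectionGroup m p (n + 1) hm, ∀ i j, g i j ∈ K) :
    LinearIndependent K fun a : contractedFinset m (m / p) (n + 1) =>
      Ideal.Quotient.mk (coinvariantIdeal (reflectionGroupOver K m p (n + 1) hm))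
        (mono K a.1) := by
  set G := reflectionGroupOver K m p (n + 1) hm
  set v := fun a : contractedFinset m (m / p) (n + 1) =>
    Ideal.Quotient.mk (coinvariantIdeal G) (mono K a.1) with hv
  -- An independent subfamily with the same span still spans the functions on the orbit points, so
  -- it has at least as many members as there are diagrams. It is therefore the whole family.
  obtain ⟨κ, α, hα, hspan, hli⟩ := exists_linearIndependent' K v
  obtain ⟨T, _, pt, x, hcard, hx, horb⟩ := exists_orbit n hm hp hK
  have : Finite κ := Finite.of_injective α hα
  have := Fintype.ofFinite κ
  set w : κ → MvPolynomial (Fin (n + 1)) K := fun k => mono K (α k).1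
  have htop := map_evalAt_span_eq_top (G := G) hx horb (s := Set.range w)
    (by
      rintro _ ⟨k, rfl⟩
      exact ⟨_, isHomogeneous_mono _⟩)
    (fun f => exists_mem_sub_mem (by
      rw [Submodule.map_span, ← Set.range_comp]
      change _ ∈ Submodule.span K (Set.range (v ∘ α))
      rw [hspan]
      exact top_le_span_mk_mono hm hp Submodule.mem_top))
  rw [Submodule.map_span, ← Set.range_comp] at htop
  have h1 : Fintype.card T ≤ Fintype.card κ := by
    have h := finrank_range_le_card (R := K) ((evalAt x).toLinearMap ∘ w)
    rwa [Set.finrank, htop, finrank_top, Module.finrank_fintype_fun_eq_card] at h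
  have h2 : Fintype.card κ = Fintype.card (contractedFinset m (m / p) (n + 1)) := by
    refine le_antisymm (Fintype.card_le_of_injective α hα) ?_
    rwa [Fintype.card_coe, card_contractedFinset (Nat.div_le_self m p), ← hcard]
  have hbij := (Fintype.bijective_iff_injective_and_card α).2 ⟨hα, h2⟩
  exact (linearIndependent_equiv (Equiv.ofBijective α hbij)).1 hli

theorem artinBasis_eq (K : Type*) [Field K] (hm : m ≠ 0) (hp : p ∣ m) :
    artinBasis K m p (n + 1) = mono K '' (contractedFinset m (m / p) (n + 1) : Set _) := by
  rw [artinBasis, diagrams_eq hm hp (by omega)]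
  congr 1
  ext a
  simp [mem_contractedFinset (Nat.div_le_self m p)]

theorem exists_basis_artinBasis (hm : m ≠ 0) (hp : p ∣ m)
    (hK : ∀ g ∈ reflectionGroup m p (n + 1) hm, ∀ i j, g i j ∈ K) :
    ∃ b : Module.Basis (artinBasis K m p (n + 1)) K
        (CoinvariantAlgebra (reflectionGroupOver K m p (n + 1) hm)),
      ∀ f, b f = Ideal.Quotient.mk
        (coinvariantIdeal (reflectionGroupOver K m p (n + 1) hm)) f.val := by
  let e : contractedFinset m (m / p) (n + 1) ≃ artinBasis K m p (n + 1) :=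
    Equiv.ofBijective (fun a => ⟨mono K a.1, by
        rw [artinBasis_eq K hm hp]
        exact Set.mem_image_of_mem _ a.2⟩)
      ⟨fun a b h => Subtype.ext (mono_injective (Subtype.mk.inj h)), fun f => by
        obtain ⟨f, hf⟩ := f
        obtain ⟨a, ha, rfl⟩ := (artinBasis_eq K hm hp).subset hf
        exact ⟨⟨a, ha⟩, rfl⟩⟩
  refine ⟨(Module.Basis.mk (linearIndependent_mk_mono hm hp hK)
    (top_le_span_mk_mono hm hp)).reindex e, fun f => ?_⟩
  obtain ⟨a, rfl⟩ := e.surjective f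
  rw [Module.Basis.reindex_apply, Equiv.symm_apply_apply, Module.Basis.mk_apply]
  rfl

theorem mk_card_filter_eq (hp : p ∣ m) :
    (PowerSeries.mk fun d => (#{a ∈ contractedFinset m (m / p) (n + 1) | ∑ i, a i = d} : ℤ)) =
      (∏ i ∈ Icc 1 n, qInt (i * m)) * qInt ((n + 1) * m / p) := by
  have hprod : ∏ i ∈ Icc 1 n, qInt (i * m) = ∏ i ∈ range n, qInt ((i + 1) * m) := by
    clear hp
    induction n with
    | zero => simp
    | succ n ih => rw [prod_Icc_succ_top (by omega), prod_range_succ, ih]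
  rw [hprod, Nat.mul_div_assoc _ hp]
  simp only [qInt]
  rw [← sum_contractedFinset_pow_sum _ (Nat.div_le_self m p)]
  ext d
  simp [PowerSeries.coeff_X_pow, eq_comm]

theorem monomialSeries_artinBasis (K : Type*) [Field K] (hm : m ≠ 0) (hp : p ∣ m) :
    monomialSeries (artinBasis K m p (n + 1)) =
      (∏ i ∈ Icc 1 n, qInt (i * m)) * qInt ((n + 1) * m / p) := by
  rw [← mk_card_filter_eq hp, monomialSeries]
  congr 1
  funext d
  have h : {f | f ∈ artinBasis K m p (n + 1) ∧ f.totalDegree = d} =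
      mono K '' ({a ∈ contractedFinset m (m / p) (n + 1) | ∑ i, a i = d} : Finset _) := by
    rw [artinBasis_eq K hm hp]
    ext f
    constructor
    · rintro ⟨⟨a, ha, rfl⟩, hd⟩
      rw [totalDegree_mono] at hd
      exact ⟨a, by simpa using ⟨ha, hd⟩, rfl⟩
    · rintro ⟨a, ha, rfl⟩
      have ha := mem_filter.1 (mem_coe.1 ha)
      exact ⟨⟨a, ha.1, rfl⟩, by rw [totalDegree_mono, ha.2]⟩
  rw [h, Set.ncard_image_of_injective _ mono_injective, Set.ncard_coe_finset]

theorem hilbertSeries_reflectionGroupOver (hm : m ≠ 0) (hp : p ∣ m)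
    (hK : ∀ g ∈ reflectionGroup m p (n + 1) hm, ∀ i j, g i j ∈ K) :
    hilbertSeries (reflectionGroupOver K m p (n + 1) hm) =
      (∏ i ∈ Icc 1 n, qInt (i * m)) * qInt ((n + 1) * m / p) := by
  rw [← mk_card_filter_eq hp]
  refine hilbertSeries_eq_mk_card (linearIndependent_mk_mono hm hp hK) fun d f hf => ?_
  have h := coinvariantIdeal_spanning n hm hp K hf
  simp_rw [← mem_contractedFinset (n := n + 1) (Nat.div_le_self m p)] at h
  exact h

end Main

end ShephardTodd

theorem mainTheorem7 (m p n : ℕ) (hm : m ≠ 0) (hp : p ∣ m) (hn : 1 ≤ n)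
    (K : Subfield ℂ)
    (hK : ∀ g ∈ ShephardTodd.reflectionGroup m p n hm, ∀ i j, g i j ∈ K) :
    -- the explicit description of the sub-staircase diagrams of type `G(m, p, n)`
    ShephardTodd.diagrams m p n =
        {a : Fin n → ℕ | ∃ j : Fin n,
          (∀ i, i < j → a i < (i.val + 1) * m) ∧
          a j < m / p ∧
          ∀ i, j < i → m / p ≤ a i ∧ a i - m / p < i.val * m} ∧
    -- the Artin basis descends to a basis of the coinvariant algebra
    (∃ b : Module.Basis (ShephardTodd.artinBasis K m p n) K
        (ShephardTodd.CoinvariantAlgebra (ShephardTodd.reflectionGroupOver K m p n hm)),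
      ∀ f, b f = Ideal.Quotient.mk
        (ShephardTodd.coinvariantIdeal (ShephardTodd.reflectionGroupOver K m p n hm)) f.val) ∧
    -- the Hilbert series of the Artin basis and of the coinvariant algebra
    ShephardTodd.monomialSeries (ShephardTodd.artinBasis K m p n) =
        (∏ i ∈ Finset.Icc 1 (n - 1), ShephardTodd.qInt (i * m)) *
          ShephardTodd.qInt (n * m / p) ∧
    ShephardTodd.hilbertSeries (ShephardTodd.reflectionGroupOver K m p n hm) =
        (∏ i ∈ Finset.Icc 1 (n - 1), ShephardTodd.qInt (i * m)) *
          ShephardTodd.qInt (n * m / p) := by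
  obtain ⟨n, rfl⟩ : ∃ k, n = k + 1 := ⟨n - 1, by omega⟩
  exact ⟨ShephardTodd.diagrams_eq hm hp hn, ShephardTodd.exists_basis_artinBasis hm hp hK,
    ShephardTodd.monomialSeries_artinBasis K hm hp,
    ShephardTodd.hilbertSeries_reflectionGroupOver hm hp hK⟩
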